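/- **Model.** A processor with power function $P$ and wake-up cost $C$ has to process finitely many jobs, each with a release time, a deadline and a processing volume. A feasible (preemptive, single-processor) schedule runs at most one job at a time, at a measurable speed $s(t)\ge 0$ (with $s(t)=0$ when no job is run); every job receives exactly its volume of work, all of it between its release time and its deadline. Between the first release time and the last deadline the processor may be in the sleep state during finitely many intervals, in which no job is run; otherwise it is active. The total energy is $\int P(s(t))\,dt$ over the active time between the first release time and the last deadline, plus $C$ for each transition from the sleep state to the active state (the processor is active just before the first release time, so there is no charge for an initial wake-up). **Parameters.** Let $C>0$, and let $P:[0,\infty)\to\mathbb R$ be strictly convex, differentiable on $(0,\infty)$, with $P(0)>0$, such that the critical speed $s^*$, i.e. the smallest $s>0$ that minimizes $P(s)/s$ over $s>0$, exists. Let $0<\varepsilon<1/2$ and $\delta>0$. Let $a_1,\dots,a_n$ ($n\ge 1$) be positive integers and $a_{\max}=\max_i a_i$. Put $$R(s)=P(s)-\tfrac{P(s^*)}{s^*}s,\quad F(x)=\tfrac{P(s^*)}{s^*}x+C,\quad d=(1-\varepsilon)s^*,\quad e=\frac{C}{R(d)},\quad f=\frac{C}{P(0)\,a_{\max}},\quad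 k=\frac{-R'(d)}{f\,R(d)},$$ $$L_i=e-f a_i,\qquad l_i=dL_i-\frac{a_i}{k},\qquad B=\frac{\sum_{i=1}^n a_i}{2k}.$$ **Instance $I_S$.** The time interval $[0,(n+1)\delta+\sum_i L_i]$ is divided, from left to right, into $n+1$ blocks of length $\delta$ that alternate with $n$ gaps $g_1,\dots,g_n$ of lengths $L_1,\dots,L_n$ (it begins and ends with a block). Level 2: for each block one job of volume $\delta s^*$ whose release time and deadline are the ends of the block. Level 1: for each $i$ one job of volume $l_i$ whose release time and deadline are the ends of $g_i$. Level 0: one job of volume $B$ whose release time and deadline are the ends of the whole interval. **Theorem.** There is a set $A'\subseteq\{1,\dots,n\}$ with $\sum_{i\in A'}a_i=\sum_{i\notin A'}a_i$ if and only if $I_S$ has a feasible schedule of total energy at most $$(n+1)\,\delta\,P(s^*)+\sum_{i=1}^n F(l_i)+B\,P'(d).$$ -/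

import Mathlib

open Set MeasureTheory

namespace SpeedScaling

/-! ### Speed scaling with a sleep state -/

/-- A job: it has to be processed between its release time and its deadline, and it needs
`volume` units of work. -/
structure Job where
  release : ℝ
  deadline : ℝ
  volume : ℝ

/-- A (preemptive, single processor) schedule for jobs indexed by `J`.  At time `t` the processor
runs the job `job t` (no job if this is `none`) at speed `speed t`.  The sleep state is
described by the finitely many maximal sleep periods; `(u, v)` stands for the period `[u, v)`. -/
structure Schedule (J : Type*) where
  job : ℝ → Option J
  speed : ℝ → ℝ
  sleepPeriods : Finset (ℝ × ℝ)

/-- First release time of an instance (with a nonempty finite type `J` of jobs). -/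
noncomputable def horizonStart {J : Type*} (I : J → Job) : ℝ := ⨅ j, (I j).release

/-- Last deadline of an instance (with a nonempty finite type `J` of jobs). -/
noncomputable def horizonEnd {J : Type*} (I : J → Job) : ℝ := ⨆ j, (I j).deadline

namespace Schedule

variable {J : Type*}

/-- The times at which the processor is in the sleep state. -/
def asleep (S : Schedule J) : Set ℝ := ⋃ p ∈ S.sleepPeriods, Ico p.1 p.2

/-- The times, between the first release time and the last deadline, at which the processor is in
the active state. -/
def active (I : J → Job) (S : Schedule J) : Set ℝ :=
  Icc (horizonStart I) (horizonEnd I) \ S.asleep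

/-- `S` is a feasible schedule of the instance `I`. -/
structure Feasible (I : J → Job) (S : Schedule J) : Prop where
  /-- sleep periods are nonempty and lie between the first release time and the last deadline -/
  sleep_valid : ∀ p ∈ S.sleepPeriods,
    horizonStart I ≤ p.1 ∧ p.1 < p.2 ∧ p.2 ≤ horizonEnd I
  /-- distinct sleep periods are separated by a time interval in the active state -/
  sleep_separated : ∀ p ∈ S.sleepPeriods, ∀ q ∈ S.sleepPeriods, p ≠ q → p.2 < q.1 ∨ q.2 < p.1
  speed_nonneg : ∀ t, 0 ≤ S.speed t
  speed_measurable : Measurable S.speed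
  job_measurable : ∀ j, MeasurableSet {t | S.job t = some j}
  /-- the speed is the rate at which work is done: it is zero when no job is run -/
  speed_idle : ∀ t, S.job t = none → S.speed t = 0
  /-- no job is run in the sleep state -/
  job_asleep : ∀ t ∈ S.asleep, S.job t = none
  /-- a job is run only between its release time and its deadline -/
  job_window : ∀ t j, S.job t = some j → t ∈ Icc (I j).release (I j).deadline
  work_integrable : ∀ j, IntegrableOn S.speed {t | S.job t = some j}
  /-- every job is completed -/
  work_eq : ∀ j, ∫ t in {t | S.job t = some j}, S.speed t = (I j).volume

/-- The number of transitions from the sleep state to the active state: the processor wakes up at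
the end of every sleep period that does not last until the last deadline. -/
noncomputable def wakeUps (I : J → Job) (S : Schedule J) : ℕ :=
  (S.sleepPeriods.filter (fun p => p.2 < horizonEnd I)).card

/-- The total energy: power `P s` per unit time in the active state at speed `s`, nothing in the
sleep state, and `C` for each transition from the sleep state to the active state. -/
noncomputable def energy (P : ℝ → ℝ) (C : ℝ) (I : J → Job) (S : Schedule J) : ℝ :=
  (∫ t in S.active I, P (S.speed t)) + C * S.wakeUps I

/-- The total energy is finite and at most `E`. -/
def EnergyAtMost (P : ℝ → ℝ) (C : ℝ) (I : J → Job) (S : Schedule J) (E : ℝ) : Prop :=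
  IntegrableOn (fun t => P (S.speed t)) (S.active I) ∧ S.energy P C I ≤ E

end Schedule

/-- `sc` is the critical speed of `P`: the least positive speed that minimizes `P s / s`. -/
def IsCriticalSpeed (P : ℝ → ℝ) (sc : ℝ) : Prop :=
  IsLeast {s : ℝ | 0 < s ∧ ∀ x : ℝ, 0 < x → P s / s ≤ P x / x} sc

/-! ### The partition problem and the parameters of the reduction -/

/-- The partition problem: some subfamily has the same sum as its complement. -/
def HasPartition {n : ℕ} (a : Fin n → ℕ) : Prop :=
  ∃ A : Finset (Fin n), ∑ i ∈ A, a i = ∑ i ∈ Aᶜ, a i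

/-- `R s = P s - (P s* / s*) s`, where `sc` is the critical speed `s*`. -/
noncomputable def R (P : ℝ → ℝ) (sc s : ℝ) : ℝ := P s - P sc / sc * s

/-- `d = (1 - ε) s*`. -/
noncomputable def dSpeed (sc ε : ℝ) : ℝ := (1 - ε) * sc

/-- `a_max`. -/
def aMax {n : ℕ} (a : Fin n → ℕ) : ℕ := Finset.univ.sup a

/-- `e = C / R d`. -/
noncomputable def eParam (P : ℝ → ℝ) (C sc ε : ℝ) : ℝ := C / R P sc (dSpeed sc ε)

/-- `f = C / (P 0 * a_max)`. -/
noncomputable def fParam (P : ℝ → ℝ) (C : ℝ) {n : ℕ} (a : Fin n → ℕ) : ℝ := C / (P 0 * aMax a)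

/-- `k = - R' d / (f * R d)`. -/
noncomputable def kParam (P : ℝ → ℝ) (C sc ε : ℝ) {n : ℕ} (a : Fin n → ℕ) : ℝ :=
  -deriv (R P sc) (dSpeed sc ε) / (fParam P C a * R P sc (dSpeed sc ε))

/-- `L_i = e - f a_i`. -/
noncomputable def gapLength (P : ℝ → ℝ) (C sc ε : ℝ) {n : ℕ} (a : Fin n → ℕ) (i : Fin n) : ℝ :=
  eParam P C sc ε - fParam P C a * a i

/-- `l_i = d L_i - a_i / k`. -/
noncomputable def lVolume (P : ℝ → ℝ) (C sc ε : ℝ) {n : ℕ} (a : Fin n → ℕ) (i : Fin n) : ℝ :=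
  dSpeed sc ε * gapLength P C sc ε a i - a i / kParam P C sc ε a

/-- `B = (∑ a_i) / (2 k)`. -/
noncomputable def BVolume (P : ℝ → ℝ) (C sc ε : ℝ) {n : ℕ} (a : Fin n → ℕ) : ℝ :=
  (∑ i, (a i : ℝ)) / (2 * kParam P C sc ε a)

/-- `F x = (P s* / s*) x + C`. -/
noncomputable def F (P : ℝ → ℝ) (C sc x : ℝ) : ℝ := P sc / sc * x + C

/-! ### The three-level instance -/

/-- Names of the jobs of the three levels. -/
inductive JobName (n : ℕ) : Type
  | level0 : JobName n
  | level1 (i : Fin n) : JobName n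
  | level2 (j : Fin (n + 1)) : JobName n

/-- Release time of the level 2 job number `j` (counted from `0`): it is preceded by the level 2
jobs `0, …, j - 1`, of length `δ` each, and by the gaps `0, …, j - 1`. -/
noncomputable def blockStart (P : ℝ → ℝ) (C sc ε δ : ℝ) {n : ℕ} (a : Fin n → ℕ) (j : ℕ) : ℝ :=
  j * δ +
    ∑ i ∈ Finset.univ.filter (fun i : Fin n => (i : ℕ) < j), gapLength P C sc ε a i

/-- The instance `I_S`.  The `n + 1` level 2 jobs (volume `δ s*`, available for `δ` time units)
alternate with `n` gaps of lengths `L_i`; the window of the `i`-th level 1 job (volume `l_i`) is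
the `i`-th gap; the level 0 job (volume `B`) is available all the time. -/
noncomputable def threeLevelInstance (P : ℝ → ℝ) (C sc ε δ : ℝ) {n : ℕ} (a : Fin n → ℕ) :
    JobName n → Job
  | .level0 =>
      { release := 0
        deadline := blockStart P C sc ε δ a n + δ
        volume := BVolume P C sc ε a }
  | .level1 i =>
      { release := blockStart P C sc ε δ a i + δ
        deadline := blockStart P C sc ε δ a ((i : ℕ) + 1)
        volume := lVolume P C sc ε a i }
  | .level2 j =>
      { release := blockStart P C sc ε δ a j
        deadline := blockStart P C sc ε δ a j + δ
        volume := δ * sc }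

/-- The energy bound `(n + 1) δ P(s*) + ∑ F(l_i) + B P'(d)`. -/
noncomputable def energyBound (P : ℝ → ℝ) (C sc ε δ : ℝ) {n : ℕ} (a : Fin n → ℕ) : ℝ :=
  (n + 1) * δ * P sc + ∑ i, F P C sc (lVolume P C sc ε a i)
    + BVolume P C sc ε a * deriv P (dSpeed sc ε)

end SpeedScaling

open SpeedScaling

/-!
The argument compares the power `P` with the line `s ↦ (P s* / s*) s`, which touches it at the
critical speed: `R` is the nonnegative difference.  All feasible schedules process the same volume,
so (`Schedule.Feasible.energy_eq`, `Setting.energyBound_eq`) the energy bound says that the integral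
of `R` over the active time plus `C` times the number of wake-ups is at most `n C + B R'(d)`, where
`R'(d) < 0`.

A gap that meets a sleep period costs at least `C`: a sleep period cannot cover a block, whose
level 2 job has to be run there, so different gaps have different sleep periods, each followed by a
wake-up (`Setting.card_sleepingGaps_le`).  In a gap `i` without sleep in which `x` units of the
level 0 job are processed, the tangent of `R` at `d` gives the lower bound `C + R'(d) x`; the values
of `L_i` and `l_i` are chosen so that this does not depend on `a i` (`Setting.gap_cost_ge`).  As the
level 0 job has volume `B`, the total is at least `n C + B R'(d)`, and equality requires that the
whole level 0 job is processed in gaps without sleep and that these gaps run at speed `d` almost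
everywhere, by strict convexity.  The latter means `x = a i / k` (`Setting.gapWork_eq`), so the
numbers `a i` of these gaps sum to `k B`, half of the total.  Conversely, given a partition, running
the gaps of one part at speed `d` and sleeping in the others attains the bound
(`Setting.schedule_of_hasPartition`).
-/

namespace SpeedScaling

/-! ### The power function relative to its critical speed -/

/-- The standing hypotheses on the power function, its critical speed, the parameters `C`, `ε`, `δ`
and the numbers `a` of the partition problem. -/
structure Setting (P : ℝ → ℝ) (C sc ε δ : ℝ) {n : ℕ} (a : Fin n → ℕ) : Prop where
  C_pos : 0 < C
  convex : StrictConvexOn ℝ (Ici 0) P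
  diff : ∀ s : ℝ, 0 < s → DifferentiableAt ℝ P s
  P0_pos : 0 < P 0
  critical : IsCriticalSpeed P sc
  eps_pos : 0 < ε
  eps_lt : ε < 1 / 2
  delta_pos : 0 < δ
  n_pos : 0 < n
  a_pos : ∀ i, 0 < a i

namespace Setting

variable {P : ℝ → ℝ} {C sc ε δ : ℝ} {n : ℕ} {a : Fin n → ℕ}

theorem sc_pos (h : Setting P C sc ε δ a) : 0 < sc := h.critical.1.1

theorem d_pos (h : Setting P C sc ε δ a) : 0 < dSpeed sc ε :=
  mul_pos (by linarith [h.eps_lt]) h.sc_pos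

theorem d_lt_sc (h : Setting P C sc ε δ a) : dSpeed sc ε < sc := by
  have := mul_pos h.eps_pos h.sc_pos
  unfold dSpeed
  linarith

theorem R_zero : R P sc 0 = P 0 := by simp [R]

theorem R_sc (h : Setting P C sc ε δ a) : R P sc sc = 0 := by
  have := h.sc_pos.ne'
  simp [R, this]

theorem R_nonneg (h : Setting P C sc ε δ a) {s : ℝ} (hs : 0 ≤ s) : 0 ≤ R P sc s := by
  rcases hs.eq_or_lt with rfl | hs
  · exact R_zero (P := P) (sc := sc) ▸ h.P0_pos.le
  · have := (le_div_iff₀ hs).1 (h.critical.1.2 s hs)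
    unfold R
    linarith

/-- Slower than the critical speed, `R` does not vanish, because the critical speed is the *least*
minimizer of `P s / s`. -/
theorem R_d_pos (h : Setting P C sc ε δ a) : 0 < R P sc (dSpeed sc ε) := by
  refine (h.R_nonneg h.d_pos.le).lt_of_ne' fun h0 => h.d_lt_sc.not_ge (h.critical.2 ⟨h.d_pos, ?_⟩)
  have : P (dSpeed sc ε) / dSpeed sc ε = P sc / sc := by
    rw [div_eq_iff h.d_pos.ne']
    unfold R at h0
    linarith
  exact this ▸ h.critical.1.2

theorem R_strictConvexOn (h : Setting P C sc ε δ a) : StrictConvexOn ℝ (Ici 0) (R P sc) := by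
  have hl : ConcaveOn ℝ (Ici (0 : ℝ)) fun s => P sc / sc * s :=
    (LinearMap.mul ℝ ℝ (P sc / sc)).concaveOn (convex_Ici 0)
  exact h.convex.sub_concaveOn hl

theorem R_hasDerivAt (h : Setting P C sc ε δ a) :
    HasDerivAt (R P sc) (deriv P (dSpeed sc ε) - P sc / sc) (dSpeed sc ε) := by
  have := (h.diff _ h.d_pos).hasDerivAt.sub ((hasDerivAt_id (dSpeed sc ε)).const_mul (P sc / sc))
  rw [mul_one] at this
  exact this

theorem deriv_R (h : Setting P C sc ε δ a) :
    deriv (R P sc) (dSpeed sc ε) = deriv P (dSpeed sc ε) - P sc / sc := h.R_hasDerivAt.deriv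

theorem tangent_lt (h : Setting P C sc ε δ a) {s : ℝ} (hs : 0 ≤ s) (hsd : s ≠ dSpeed sc ε) :
    R P sc (dSpeed sc ε) + deriv (R P sc) (dSpeed sc ε) * (s - dSpeed sc ε) < R P sc s := by
  have hd := h.R_hasDerivAt.differentiableAt.hasDerivAt
  have hdm : dSpeed sc ε ∈ Ici (0 : ℝ) := h.d_pos.le
  rcases hsd.lt_or_gt with hlt | hlt
  · have := h.R_strictConvexOn.slope_lt_of_hasDerivAt (mem_Ici.2 hs) hdm hlt hd
    rw [slope_def_field, div_lt_iff₀ (by linarith)] at this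
    linarith
  · have := h.R_strictConvexOn.lt_slope_of_hasDerivAt hdm (mem_Ici.2 hs) hlt hd
    rw [slope_def_field, lt_div_iff₀ (by linarith)] at this
    linarith

theorem tangent_le (h : Setting P C sc ε δ a) {s : ℝ} (hs : 0 ≤ s) :
    R P sc (dSpeed sc ε) + deriv (R P sc) (dSpeed sc ε) * (s - dSpeed sc ε) ≤ R P sc s := by
  by_cases hsd : s = dSpeed sc ε
  · simp [hsd]
  · exact (h.tangent_lt hs hsd).le

theorem R_d_le (h : Setting P C sc ε δ a) : R P sc (dSpeed sc ε) ≤ ε * P 0 := by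
  have := h.R_strictConvexOn.convexOn.2 (mem_Ici.2 le_rfl) (mem_Ici.2 h.sc_pos.le)
    h.eps_pos.le (show 0 ≤ 1 - ε by linarith [h.eps_lt]) (by ring)
  simpa [h.R_sc, R_zero, dSpeed] using this

/-- The tangent of `R` at `d`, evaluated at the critical speed, where `R` vanishes. -/
theorem R_d_le_deriv (h : Setting P C sc ε δ a) :
    R P sc (dSpeed sc ε) ≤ -deriv (R P sc) (dSpeed sc ε) * (ε * sc) := by
  have := h.tangent_le h.sc_pos.le
  rw [h.R_sc] at this
  have e : sc - dSpeed sc ε = ε * sc := by unfold dSpeed; ring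
  rw [e] at this
  linarith

theorem deriv_R_neg (h : Setting P C sc ε δ a) : deriv (R P sc) (dSpeed sc ε) < 0 := by
  have h1 := h.R_d_pos.trans_le h.R_d_le_deriv
  have := pos_of_mul_pos_left h1 (mul_pos h.eps_pos h.sc_pos).le
  linarith

/-! ### The parameters of the reduction -/

theorem a_le_aMax (i : Fin n) : a i ≤ aMax a := Finset.le_sup (Finset.mem_univ i)

theorem aMax_pos (h : Setting P C sc ε δ a) : (0 : ℝ) < aMax a :=
  Nat.cast_pos.2 ((h.a_pos ⟨0, h.n_pos⟩).trans_le (a_le_aMax _))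

theorem f_pos (h : Setting P C sc ε δ a) : 0 < fParam P C a :=
  div_pos h.C_pos (mul_pos h.P0_pos h.aMax_pos)

theorem k_pos (h : Setting P C sc ε δ a) : 0 < kParam P C sc ε a :=
  div_pos (by linarith [h.deriv_R_neg]) (mul_pos h.f_pos h.R_d_pos)

/-- The defining relation of `k`: at the rate `-R'(d)`, the work `1 / k` saves as much as
shortening a gap that is processed at speed `d` by `f`. -/
theorem deriv_mul_div_k (h : Setting P C sc ε δ a) (x : ℝ) :
    -deriv (R P sc) (dSpeed sc ε) * (x / kParam P C sc ε a)
      = x * fParam P C a * R P sc (dSpeed sc ε) := by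
  have h1 : deriv (R P sc) (dSpeed sc ε) ≠ 0 := h.deriv_R_neg.ne
  have h2 := h.f_pos.ne'
  have h3 := h.R_d_pos.ne'
  unfold kParam
  field_simp

theorem f_mul_a_le (h : Setting P C sc ε δ a) (i : Fin n) : fParam P C a * a i ≤ C / P 0 := by
  have h1 := h.aMax_pos
  have h2 := h.P0_pos
  have h3 : (a i : ℝ) ≤ aMax a := Nat.cast_le.2 (a_le_aMax i)
  calc fParam P C a * a i ≤ fParam P C a * aMax a := mul_le_mul_of_nonneg_left h3 h.f_pos.le
    _ = C / P 0 := by unfold fParam; field_simp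

theorem gapLength_gt (h : Setting P C sc ε δ a) (i : Fin n) :
    C / P 0 < gapLength P C sc ε a i := by
  have h1 := h.R_d_pos
  have h2 := h.P0_pos
  have h3 : 2 * (C / P 0) < eParam P C sc ε := by
    unfold eParam
    rw [lt_div_iff₀ h1, mul_assoc, div_mul_eq_mul_div, mul_div_assoc', div_lt_iff₀ h2]
    have : R P sc (dSpeed sc ε) * 2 < P 0 := by
      nlinarith [h.R_d_le, h.eps_lt]
    nlinarith [h.C_pos]
  have := h.f_mul_a_le i
  unfold gapLength
  linarith

theorem gapLength_pos (h : Setting P C sc ε δ a) (i : Fin n) : 0 < gapLength P C sc ε a i :=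
  (div_pos h.C_pos h.P0_pos).trans (h.gapLength_gt i)

/-- Processing a gap at the constant speed `d` costs, relative to the critical speed, the wake-up
cost `C` up to a term proportional to `a i`. -/
theorem gapLength_mul_R (h : Setting P C sc ε δ a) (i : Fin n) :
    gapLength P C sc ε a i * R P sc (dSpeed sc ε)
      = C - a i * fParam P C a * R P sc (dSpeed sc ε) := by
  have h1 := h.R_d_pos.ne'
  unfold gapLength eParam
  field_simp

theorem div_k_pos (h : Setting P C sc ε δ a) (i : Fin n) : 0 < a i / kParam P C sc ε a :=
  div_pos (Nat.cast_pos.2 (h.a_pos i)) h.k_pos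

theorem lVolume_pos (h : Setting P C sc ε δ a) (i : Fin n) : 0 < lVolume P C sc ε a i := by
  have h1 : a i / kParam P C sc ε a ≤ C / P 0 * (ε * sc) := by
    have h2 := h.deriv_mul_div_k (a i)
    have h3 : a i * fParam P C a * R P sc (dSpeed sc ε)
        ≤ C / P 0 * (-deriv (R P sc) (dSpeed sc ε) * (ε * sc)) := by
      rw [mul_comm (a i : ℝ)]
      exact mul_le_mul (h.f_mul_a_le i) h.R_d_le_deriv h.R_d_pos.le
        (div_pos h.C_pos h.P0_pos).le
    have h4 := h.deriv_R_neg
    refine le_of_mul_le_mul_left (a := -deriv (R P sc) (dSpeed sc ε)) ?_ (by linarith)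
    rw [h2]
    linarith
  have h5 := mul_lt_mul_of_pos_left (h.gapLength_gt i) h.d_pos
  have h6 : C / P 0 * (ε * sc) ≤ dSpeed sc ε * (C / P 0) := by
    have h7 := div_pos h.C_pos h.P0_pos
    have h8 : ε * sc ≤ dSpeed sc ε :=
      mul_le_mul_of_nonneg_right (by linarith [h.eps_lt]) h.sc_pos.le
    rw [mul_comm]
    exact mul_le_mul_of_nonneg_right h8 h7.le
  unfold lVolume
  linarith

theorem lVolume_lt (h : Setting P C sc ε δ a) (i : Fin n) :
    lVolume P C sc ε a i < dSpeed sc ε * gapLength P C sc ε a i := by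
  have := h.div_k_pos i
  unfold lVolume
  linarith

/-! ### The geometry of the instance -/

theorem blockStart_zero : blockStart P C sc ε δ a 0 = 0 := by simp [blockStart]

theorem blockStart_succ (i : Fin n) :
    blockStart P C sc ε δ a (i + 1)
      = blockStart P C sc ε δ a i + δ + gapLength P C sc ε a i := by
  have : Finset.univ.filter (fun j : Fin n => (j : ℕ) < i + 1)
      = insert i (Finset.univ.filter fun j : Fin n => (j : ℕ) < i) := by
    ext j
    simp [Fin.ext_iff]
    omega
  unfold blockStart
  rw [this, Finset.sum_insert (by simp)]
  push_cast
  ring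

/-- Past the last block the recursion continues without gaps; in particular
`blockStart (n + 1)` is the end of the instance. -/
theorem blockStart_succ_of_le {j : ℕ} (hj : n ≤ j) :
    blockStart P C sc ε δ a (j + 1) = blockStart P C sc ε δ a j + δ := by
  have : Finset.univ.filter (fun i : Fin n => (i : ℕ) < j + 1)
      = Finset.univ.filter fun i : Fin n => (i : ℕ) < j := by
    ext i
    simp
    omega
  unfold blockStart
  rw [this]
  push_cast
  ring

theorem blockStart_add_le (h : Setting P C sc ε δ a) (j : ℕ) :
    blockStart P C sc ε δ a j + δ ≤ blockStart P C sc ε δ a (j + 1) := by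
  by_cases hj : j < n
  · have := blockStart_succ (P := P) (C := C) (sc := sc) (ε := ε) (δ := δ) (a := a) ⟨j, hj⟩
    have h2 := h.gapLength_pos ⟨j, hj⟩
    simp only at this
    linarith
  · exact (blockStart_succ_of_le (not_lt.1 hj)).ge

theorem blockStart_strictMono (h : Setting P C sc ε δ a) :
    StrictMono (blockStart P C sc ε δ a) :=
  strictMono_nat_of_lt_succ fun j => by linarith [h.blockStart_add_le j, h.delta_pos]

theorem blockStart_add_le_of_lt (h : Setting P C sc ε δ a) {i j : ℕ} (hij : i < j) :
    blockStart P C sc ε δ a i + δ ≤ blockStart P C sc ε δ a j :=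
  (h.blockStart_add_le i).trans (h.blockStart_strictMono.monotone hij)

theorem blockStart_nonneg (h : Setting P C sc ε δ a) (j : ℕ) : 0 ≤ blockStart P C sc ε δ a j := by
  rw [← blockStart_zero (P := P) (C := C) (sc := sc) (ε := ε) (δ := δ) (a := a)]
  exact h.blockStart_strictMono.monotone (Nat.zero_le j)

theorem blockStart_end :
    blockStart P C sc ε δ a (n + 1) = blockStart P C sc ε δ a n + δ := blockStart_succ_of_le le_rfl

theorem window_subset (h : Setting P C sc ε δ a) (j : JobName n) :
    0 ≤ (threeLevelInstance P C sc ε δ a j).release ∧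
      (threeLevelInstance P C sc ε δ a j).deadline ≤ blockStart P C sc ε δ a (n + 1) := by
  have hd := h.delta_pos
  have hm := h.blockStart_strictMono.monotone
  cases j with
  | level0 => exact ⟨le_rfl, blockStart_end.ge⟩
  | level1 i => exact ⟨by simpa [threeLevelInstance] using add_nonneg (h.blockStart_nonneg i) hd.le,
      hm (by omega)⟩
  | level2 j => exact ⟨h.blockStart_nonneg j, (h.blockStart_add_le j).trans (hm (by omega))⟩

instance : Nonempty (JobName n) := ⟨.level0⟩

theorem horizonStart_eq (h : Setting P C sc ε δ a) :
    horizonStart (threeLevelInstance P C sc ε δ a) = 0 :=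
  le_antisymm (ciInf_le ⟨0, by rintro _ ⟨j, rfl⟩; exact (h.window_subset j).1⟩ JobName.level0)
    (le_ciInf fun j => (h.window_subset j).1)

theorem horizonEnd_eq (h : Setting P C sc ε δ a) :
    horizonEnd (threeLevelInstance P C sc ε δ a) = blockStart P C sc ε δ a (n + 1) :=
  le_antisymm (ciSup_le fun j => (h.window_subset j).2)
    (blockStart_end.le.trans
      (le_ciSup (f := fun j => (threeLevelInstance P C sc ε δ a j).deadline)
        ⟨_, by rintro _ ⟨j, rfl⟩; exact (h.window_subset j).2⟩ JobName.level0))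

end Setting

/-- The job names as a disjoint union of the three levels. -/
def JobName.equivSum (n : ℕ) : JobName n ≃ Unit ⊕ Fin n ⊕ Fin (n + 1) where
  toFun
    | .level0 => .inl ()
    | .level1 i => .inr (.inl i)
    | .level2 j => .inr (.inr j)
  invFun
    | .inl _ => .level0
    | .inr (.inl i) => .level1 i
    | .inr (.inr j) => .level2 j
  left_inv j := by cases j <;> rfl
  right_inv j := by rcases j with _ | _ | _ <;> rfl

instance (n : ℕ) : Fintype (JobName n) := Fintype.ofEquiv _ (JobName.equivSum n).symm

theorem JobName.sum_eq {n : ℕ} (g : JobName n → ℝ) :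
    ∑ j, g j = g .level0 + (∑ i, g (.level1 i) + ∑ j, g (.level2 j)) := by
  rw [← (JobName.equivSum n).symm.sum_comp g, Fintype.sum_sum_type, Fintype.sum_sum_type]
  simp [JobName.equivSum]

/-! ### Energy in terms of `R` -/

/-- The energy bound, with the cost of processing the whole volume at the critical speed split
off. -/
theorem Setting.energyBound_eq {P : ℝ → ℝ} {C sc ε δ : ℝ} {n : ℕ} {a : Fin n → ℕ}
    (h : Setting P C sc ε δ a) :
    energyBound P C sc ε δ a
      = P sc / sc * ∑ j, (threeLevelInstance P C sc ε δ a j).volume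
        + (n * C + BVolume P C sc ε a * deriv (R P sc) (dSpeed sc ε)) := by
  have := h.sc_pos.ne'
  rw [JobName.sum_eq, h.deriv_R]
  simp only [threeLevelInstance, energyBound, F, Finset.sum_add_distrib, ← Finset.mul_sum,
    Finset.sum_const, Finset.card_univ, Fintype.card_fin, nsmul_eq_mul]
  push_cast
  field_simp
  ring

/-- At the rate `-R'(d)`, the level 0 job can save half the sum of the quantities
`a i * f * R d`. -/
theorem Setting.BVolume_mul_deriv {P : ℝ → ℝ} {C sc ε δ : ℝ} {n : ℕ} {a : Fin n → ℕ}
    (h : Setting P C sc ε δ a) :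
    BVolume P C sc ε a * deriv (R P sc) (dSpeed sc ε)
      = -((∑ i, (a i : ℝ)) / 2 * fParam P C a * R P sc (dSpeed sc ε)) := by
  have := h.deriv_mul_div_k ((∑ i, (a i : ℝ)) / 2)
  rw [← this, BVolume, div_div]
  ring

namespace Schedule.Feasible

variable {J : Type*} [Fintype J] {I : J → Job} {S : Schedule J}

theorem speed_eq_sum (hS : S.Feasible I) (t : ℝ) :
    S.speed t = ∑ j, {t | S.job t = some j}.indicator S.speed t := by
  classical
  rcases hj : S.job t with _ | j
  · simp [indicator, hj, hS.speed_idle t hj]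
  · simp [indicator, hj]

theorem integrable_speed (hS : S.Feasible I) : Integrable S.speed := by
  have : S.speed = fun t => ∑ j, {t | S.job t = some j}.indicator S.speed t :=
    funext hS.speed_eq_sum
  rw [this]
  exact integrable_finsetSum _ fun j _ =>
    (integrable_indicator_iff (hS.job_measurable j)).2 (hS.work_integrable j)

theorem setIntegral_speed (hS : S.Feasible I) (s : Set ℝ) :
    ∫ t in s, S.speed t = ∑ j, ∫ t in s ∩ {t | S.job t = some j}, S.speed t := by
  calc ∫ t in s, S.speed t = ∫ t in s, ∑ j, {t | S.job t = some j}.indicator S.speed t := by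
        simp_rw [← hS.speed_eq_sum]
    _ = ∑ j, ∫ t in s, {t | S.job t = some j}.indicator S.speed t :=
        integral_finsetSum _ fun j _ => ((integrable_indicator_iff (hS.job_measurable j)).2
          (hS.work_integrable j)).integrableOn
    _ = _ := by simp_rw [setIntegral_indicator (hS.job_measurable _)]

theorem window_subset_horizon (j : J) :
    Icc (I j).release (I j).deadline ⊆ Icc (horizonStart I) (horizonEnd I) :=
  Icc_subset_Icc (ciInf_le (finite_range fun j => (I j).release).bddBelow j)
    (le_ciSup (finite_range fun j => (I j).deadline).bddAbove j)

/-- All the work is done in the active state. -/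
theorem setIntegral_speed_active (hS : S.Feasible I) :
    ∫ t in S.active I, S.speed t = ∑ j, (I j).volume := by
  rw [setIntegral_eq_integral_of_forall_compl_eq_zero, ← setIntegral_univ,
    hS.setIntegral_speed univ]
  · simp [hS.work_eq]
  · intro t ht
    rcases hj : S.job t with _ | j
    · exact hS.speed_idle t hj
    · refine (ht ⟨window_subset_horizon j (hS.job_window t j hj), fun h => ?_⟩).elim
      simp [hS.job_asleep t h] at hj

theorem integrableOn_R (hS : S.Feasible I) {P : ℝ → ℝ}
    (hP : IntegrableOn (fun t => P (S.speed t)) (S.active I)) (sc : ℝ) :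
    IntegrableOn (fun t => R P sc (S.speed t)) (S.active I) :=
  hP.sub (hS.integrable_speed.integrableOn.const_mul (P sc / sc))

/-- The energy of a feasible schedule: processing the whole volume at the critical speed, and the
excess `R` over it. -/
theorem energy_eq (hS : S.Feasible I) {P : ℝ → ℝ}
    (hP : IntegrableOn (fun t => P (S.speed t)) (S.active I)) (C sc : ℝ) :
    S.energy P C I = P sc / sc * ∑ j, (I j).volume
      + ((∫ t in S.active I, R P sc (S.speed t)) + C * S.wakeUps I) := by
  have h1 : ∫ t in S.active I, R P sc (S.speed t)
      = (∫ t in S.active I, P (S.speed t)) - P sc / sc * ∫ t in S.active I, S.speed t := by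
    rw [← integral_const_mul]
    exact integral_sub hP (hS.integrable_speed.integrableOn.const_mul (P sc / sc))
  rw [h1, hS.setIntegral_speed_active, energy]
  ring

end Schedule.Feasible

/-! ### Lower bound for the energy of a feasible schedule -/

namespace Setting

variable {P : ℝ → ℝ} {C sc ε δ : ℝ} {n : ℕ} {a : Fin n → ℕ} {S : Schedule (JobName n)}

variable (P C sc ε δ a) in
/-- The `i`-th gap, as an open interval. -/
def gap (i : Fin n) : Set ℝ :=
  Ioo (blockStart P C sc ε δ a i + δ) (blockStart P C sc ε δ a (i + 1))

theorem measurableSet_gap (i : Fin n) : MeasurableSet (gap P C sc ε δ a i) := measurableSet_Ioo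

theorem volume_real_gap (h : Setting P C sc ε δ a) (i : Fin n) :
    volume.real (gap P C sc ε δ a i) = gapLength P C sc ε a i := by
  rw [gap, Real.volume_real_Ioo_of_le (h.blockStart_add_le i), blockStart_succ]
  ring

theorem volume_gap_ne_top (i : Fin n) : volume (gap P C sc ε δ a i) ≠ ⊤ := by
  simp [gap]

theorem gap_disjoint (h : Setting P C sc ε δ a) :
    Pairwise fun i j => Disjoint (gap P C sc ε δ a i) (gap P C sc ε δ a j) := by
  have key : ∀ i j : Fin n, i < j → Disjoint (gap P C sc ε δ a i) (gap P C sc ε δ a j) := by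
    intro i j hij
    refine Set.disjoint_left.2 fun t hi hj => ?_
    have := h.blockStart_strictMono.monotone (show (i : ℕ) + 1 ≤ j from hij)
    linarith [hi.2, hj.1, h.delta_pos]
  intro i j hij
  rcases hij.lt_or_gt with hlt | hlt
  · exact key i j hlt
  · exact (key j i hlt).symm

/-- No sleep period covers a block, since the level 2 job of the block has to be run there. -/
theorem not_block_asleep (h : Setting P C sc ε δ a)
    (hS : S.Feasible (threeLevelInstance P C sc ε δ a)) {p : ℝ × ℝ} (hp : p ∈ S.sleepPeriods)
    {j : ℕ} (hj : j < n + 1) (h1 : p.1 ≤ blockStart P C sc ε δ a j)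
    (h2 : blockStart P C sc ε δ a j + δ ≤ p.2) : False := by
  have hw := hS.work_eq (.level2 ⟨j, hj⟩)
  -- at most the right end of the block is left for the job
  have hsub : {t | S.job t = some (.level2 ⟨j, hj⟩)} ⊆ {blockStart P C sc ε δ a j + δ} := by
    intro t ht
    have hwin : t ∈ Icc _ _ := hS.job_window t _ ht
    by_contra hne
    have hlt : t < blockStart P C sc ε δ a j + δ := lt_of_le_of_ne hwin.2 hne
    have := hS.job_asleep t (mem_biUnion hp ⟨h1.trans hwin.1, hlt.trans_le h2⟩)
    simp [this] at ht
  rw [setIntegral_measure_zero _ (measure_mono_null hsub (measure_singleton _))] at hw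
  exact (mul_pos h.delta_pos h.sc_pos).ne hw

open Classical in
variable (P C sc ε δ a) in
/-- The gaps that meet a sleep period. -/
noncomputable def sleepingGaps (S : Schedule (JobName n)) : Finset (Fin n) :=
  Finset.univ.filter fun i => ∃ p ∈ S.sleepPeriods,
    p.1 < blockStart P C sc ε δ a (i + 1) ∧ blockStart P C sc ε δ a i + δ < p.2

/-- The sleep periods of distinct gaps are distinct, and each of them is followed by a wake-up. -/
theorem card_sleepingGaps_le (h : Setting P C sc ε δ a)
    (hS : S.Feasible (threeLevelInstance P C sc ε δ a)) :
    (sleepingGaps P C sc ε δ a S).card ≤ S.wakeUps (threeLevelInstance P C sc ε δ a) := by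
  classical
  have hch : ∀ i : Fin n, ∃ p : ℝ × ℝ, i ∈ sleepingGaps P C sc ε δ a S → p ∈ S.sleepPeriods ∧
      p.1 < blockStart P C sc ε δ a (i + 1) ∧ blockStart P C sc ε δ a i + δ < p.2 := by
    intro i
    by_cases hi : i ∈ sleepingGaps P C sc ε δ a S
    · obtain ⟨p, hp⟩ := (Finset.mem_filter.1 hi).2
      exact ⟨p, fun _ => hp⟩
    · exact ⟨0, fun h' => (hi h').elim⟩
  choose p hp using hch
  have key : ∀ i ∈ sleepingGaps P C sc ε δ a S, ∀ j ∈ sleepingGaps P C sc ε δ a S, i < j →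
      p i ≠ p j := by
    intro i hi j hj hij he
    -- a common sleep period would cover the block between the two gaps
    refine h.not_block_asleep hS (hp i hi).1 (j := i + 1) (by omega) (hp i hi).2.1.le ?_
    have := h.blockStart_strictMono.monotone (show (i : ℕ) + 1 ≤ j from hij)
    rw [he]
    linarith [(hp j hj).2.2]
  refine Finset.card_le_card_of_injOn p (fun i hi => ?_) (fun i hi j hj he => ?_)
  · refine Finset.mem_coe.2 (Finset.mem_filter.2 ⟨(hp i hi).1, ?_⟩)
    rw [h.horizonEnd_eq, blockStart_end]
    by_contra hlt
    exact h.not_block_asleep hS (hp i hi).1 (Nat.lt_succ_self n)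
      ((hp i hi).2.1.le.trans (h.blockStart_strictMono.monotone i.2)) (not_lt.1 hlt)
  · by_contra hne
    rcases lt_or_gt_of_ne hne with hlt | hlt
    · exact key i hi j hj hlt he
    · exact key j hj i hi hlt he.symm

theorem gap_subset_active (h : Setting P C sc ε δ a) {i : Fin n}
    (hi : i ∉ sleepingGaps P C sc ε δ a S) :
    gap P C sc ε δ a i ⊆ S.active (threeLevelInstance P C sc ε δ a) := by
  intro t ht
  refine ⟨?_, fun hsl => ?_⟩
  · rw [h.horizonStart_eq, h.horizonEnd_eq]
    exact ⟨by linarith [ht.1, h.blockStart_nonneg i, h.delta_pos],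
      ht.2.le.trans (h.blockStart_strictMono.monotone (by omega))⟩
  · obtain ⟨p, hp, hpt⟩ := mem_iUnion₂.1 hsl
    exact hi (Finset.mem_filter.2 ⟨Finset.mem_univ _, p, hp, hpt.1.trans_lt ht.2,
      ht.1.trans hpt.2⟩)

variable (P C sc ε δ a) in
/-- The part of the level 0 job that is processed in the `i`-th gap. -/
noncomputable def gapWork (S : Schedule (JobName n)) (i : Fin n) : ℝ :=
  ∫ t in gap P C sc ε δ a i ∩ {t | S.job t = some .level0}, S.speed t

/-- Apart from the level 0 job, only the level 1 job of a gap can be run in the gap. -/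
theorem setIntegral_speed_gap (h : Setting P C sc ε δ a)
    (hS : S.Feasible (threeLevelInstance P C sc ε δ a)) (i : Fin n) :
    ∫ t in gap P C sc ε δ a i, S.speed t
      = gapWork P C sc ε δ a S i + lVolume P C sc ε a i := by
  have hm := h.blockStart_strictMono
  have hb := h.blockStart_add_le
  rw [hS.setIntegral_speed, JobName.sum_eq, Finset.sum_eq_single i]
  · have h2 : ∀ j, ∫ t in gap P C sc ε δ a i ∩ {t | S.job t = some (.level2 j)}, S.speed t
        = 0 := by
      intro j
      have : gap P C sc ε δ a i ∩ {t | S.job t = some (.level2 j)} = ∅ := by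
        refine eq_empty_of_forall_notMem fun t ht => ?_
        have hwin : t ∈ Icc _ _ := hS.job_window t _ ht.2
        have hw2 : t ≤ blockStart P C sc ε δ a j + δ := hwin.2
        have hw1 : blockStart P C sc ε δ a j ≤ t := hwin.1
        rcases le_or_gt (j : ℕ) i with hle | hlt
        · linarith [ht.1.1, hm.monotone hle]
        · linarith [ht.1.2, hm.monotone (show (i : ℕ) + 1 ≤ j from hlt)]
      simp [this]
    have h1 : ∫ t in gap P C sc ε δ a i ∩ {t | S.job t = some (.level1 i)}, S.speed t
        = lVolume P C sc ε a i := by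
      refine Eq.trans (setIntegral_congr_set ?_) (hS.work_eq (.level1 i))
      -- the window of the job is the closed gap
      have hsub : {t | S.job t = some (.level1 i)} ⊆
          Icc (blockStart P C sc ε δ a i + δ) (blockStart P C sc ε δ a (i + 1)) :=
        fun t ht => hS.job_window t _ ht
      have hae : (gap P C sc ε δ a i ∩ {t | S.job t = some (.level1 i)} : Set ℝ) =ᵐ[volume]
          (Icc (blockStart P C sc ε δ a i + δ) (blockStart P C sc ε δ a (i + 1)) ∩
            {t | S.job t = some (.level1 i)} : Set ℝ) :=
        ae_eq_set_inter Ioo_ae_eq_Icc (ae_eq_refl _)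
      rwa [inter_eq_self_of_subset_right hsub] at hae
    rw [h1, Finset.sum_eq_zero fun j _ => h2 j, add_zero]
    rfl
  · intro j _ hji
    have : gap P C sc ε δ a i ∩ {t | S.job t = some (.level1 j)} = ∅ := by
      refine eq_empty_of_forall_notMem fun t ht => ?_
      have hwin : t ∈ Icc _ _ := hS.job_window t _ ht.2
      have hw2 : t ≤ blockStart P C sc ε δ a (j + 1) := hwin.2
      have hw1 : blockStart P C sc ε δ a j + δ ≤ t := hwin.1
      rcases lt_or_gt_of_ne hji with hlt | hlt
      · linarith [ht.1.1, h.delta_pos, hm.monotone (show (j : ℕ) + 1 ≤ i from hlt)]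
      · linarith [ht.1.2, h.delta_pos, hm.monotone (show (i : ℕ) + 1 ≤ j from hlt)]
    simp [this]
  · simp

theorem sum_gapWork_le (h : Setting P C sc ε δ a)
    (hS : S.Feasible (threeLevelInstance P C sc ε δ a)) (s : Finset (Fin n)) :
    ∑ i ∈ s, gapWork P C sc ε δ a S i ≤ BVolume P C sc ε a := by
  have hmeas := hS.job_measurable .level0
  calc ∑ i ∈ s, gapWork P C sc ε δ a S i
      = ∫ t in ⋃ i ∈ s, gap P C sc ε δ a i ∩ {t | S.job t = some .level0}, S.speed t :=
        (integral_biUnion_finset s (fun i _ => (measurableSet_gap i).inter hmeas)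
          (fun i _ j _ hij => (h.gap_disjoint hij).mono inter_subset_left inter_subset_left)
          fun i _ => hS.integrable_speed.integrableOn).symm
    _ ≤ ∫ t in {t | S.job t = some .level0}, S.speed t :=
        setIntegral_mono_set hS.integrable_speed.integrableOn
          (ae_of_all _ hS.speed_nonneg)
          (iUnion₂_subset fun i _ => inter_subset_right).eventuallyLE
    _ = BVolume P C sc ε a := hS.work_eq .level0

/-- The tangent of `R` at `d` integrates over a gap to `C`, minus the rate `-R'(d)` times the
level 0 work done in the gap: this is what the choice of `L_i` and `l_i` achieves. -/
theorem setIntegral_tangent (h : Setting P C sc ε δ a)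
    (hS : S.Feasible (threeLevelInstance P C sc ε δ a)) (i : Fin n) :
    ∫ t in gap P C sc ε δ a i, (R P sc (dSpeed sc ε)
        + deriv (R P sc) (dSpeed sc ε) * (S.speed t - dSpeed sc ε))
      = C + deriv (R P sc) (dSpeed sc ε) * gapWork P C sc ε δ a S i := by
  have hc : ∀ x : ℝ, IntegrableOn (fun _ => x) (gap P C sc ε δ a i) :=
    fun x => integrableOn_const (volume_gap_ne_top i)
  have hs : IntegrableOn S.speed (gap P C sc ε δ a i) := hS.integrable_speed.integrableOn
  have hsd : IntegrableOn (fun t => S.speed t - dSpeed sc ε) (gap P C sc ε δ a i) := hs.sub (hc _)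
  rw [integral_add (hc _) (hsd.const_mul _), integral_const_mul,
    integral_sub hs (hc _), setIntegral_const, setIntegral_const, h.volume_real_gap,
    h.setIntegral_speed_gap hS, smul_eq_mul, smul_eq_mul, h.gapLength_mul_R]
  have := h.deriv_mul_div_k (a i)
  unfold lVolume
  linear_combination this

theorem integrableOn_tangent
    (hS : S.Feasible (threeLevelInstance P C sc ε δ a)) (i : Fin n) :
    IntegrableOn (fun t => R P sc (dSpeed sc ε)
        + deriv (R P sc) (dSpeed sc ε) * (S.speed t - dSpeed sc ε)) (gap P C sc ε δ a i) := by
  have hc : ∀ x : ℝ, IntegrableOn (fun _ => x) (gap P C sc ε δ a i) :=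
    fun x => integrableOn_const (volume_gap_ne_top i)
  exact (hc _).add ((hS.integrable_speed.integrableOn.sub (hc _)).const_mul _)

theorem gap_cost_ge (h : Setting P C sc ε δ a)
    (hS : S.Feasible (threeLevelInstance P C sc ε δ a)) {i : Fin n}
    (hR : IntegrableOn (fun t => R P sc (S.speed t)) (gap P C sc ε δ a i)) :
    C + deriv (R P sc) (dSpeed sc ε) * gapWork P C sc ε δ a S i
      ≤ ∫ t in gap P C sc ε δ a i, R P sc (S.speed t) := by
  rw [← h.setIntegral_tangent hS]
  exact setIntegral_mono (integrableOn_tangent hS i) hR fun t => h.tangent_le (hS.speed_nonneg t)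

/-- Equality in the tangent bound forces the speed `d` throughout the gap, which determines the
level 0 work done there. -/
theorem gapWork_eq (h : Setting P C sc ε δ a)
    (hS : S.Feasible (threeLevelInstance P C sc ε δ a)) {i : Fin n}
    (hR : IntegrableOn (fun t => R P sc (S.speed t)) (gap P C sc ε δ a i))
    (heq : ∫ t in gap P C sc ε δ a i, R P sc (S.speed t)
      ≤ C + deriv (R P sc) (dSpeed sc ε) * gapWork P C sc ε δ a S i) :
    gapWork P C sc ε δ a S i = a i / kParam P C sc ε a := by
  have hzero : ∫ t in gap P C sc ε δ a i, (R P sc (S.speed t) - (R P sc (dSpeed sc ε)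
        + deriv (R P sc) (dSpeed sc ε) * (S.speed t - dSpeed sc ε))) = 0 := by
    rw [integral_sub hR (integrableOn_tangent hS i), h.setIntegral_tangent hS]
    linarith [h.gap_cost_ge hS hR]
  rw [setIntegral_eq_zero_iff_of_nonneg_ae
    (ae_of_all _ fun t => sub_nonneg.2 (h.tangent_le (hS.speed_nonneg t)))
    (hR.sub (integrableOn_tangent hS i))] at hzero
  have hd : ∫ t in gap P C sc ε δ a i, S.speed t
      = ∫ t in gap P C sc ε δ a i, dSpeed sc ε := by
    refine integral_congr_ae ?_
    filter_upwards [hzero] with t ht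
    by_contra hne
    have := h.tangent_lt (hS.speed_nonneg t) hne
    simp only [Pi.zero_apply] at ht
    linarith
  rw [h.setIntegral_speed_gap hS, setIntegral_const, h.volume_real_gap, smul_eq_mul] at hd
  unfold lVolume at hd
  linarith

/-- A schedule within the energy bound spends no more than `C - (-R'(d)) x` on each gap without
sleep, `x` being the level 0 work in the gap, and does the whole level 0 job in these gaps; so the
numbers of these gaps have half the total sum. -/
theorem hasPartition_of_schedule (h : Setting P C sc ε δ a)
    (hS : S.Feasible (threeLevelInstance P C sc ε δ a))
    (hE : S.EnergyAtMost P C (threeLevelInstance P C sc ε δ a) (energyBound P C sc ε δ a)) :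
    HasPartition a := by
  classical
  obtain ⟨hint, hle⟩ := hE
  rw [hS.energy_eq hint C sc, h.energyBound_eq, add_le_add_iff_left] at hle
  have hRint := hS.integrableOn_R hint sc
  set Z := sleepingGaps P C sc ε δ a S with hZ
  have hact : ∀ i ∈ Zᶜ, gap P C sc ε δ a i ⊆ S.active (threeLevelInstance P C sc ε δ a) :=
    fun i hi => h.gap_subset_active (Finset.mem_compl.1 hi)
  have hRgap : ∀ i ∈ Zᶜ, IntegrableOn (fun t => R P sc (S.speed t)) (gap P C sc ε δ a i) :=
    fun i hi => hRint.mono_set (hact i hi)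
  have hsum : ∑ i ∈ Zᶜ, ∫ t in gap P C sc ε δ a i, R P sc (S.speed t)
      ≤ ∫ t in S.active (threeLevelInstance P C sc ε δ a), R P sc (S.speed t) := by
    rw [← integral_biUnion_finset Zᶜ (fun i _ => measurableSet_gap i)
      (fun i _ j _ hij => h.gap_disjoint hij) hRgap]
    exact setIntegral_mono_set hRint
      (ae_of_all _ fun t => h.R_nonneg (hS.speed_nonneg t)) (iUnion₂_subset hact).eventuallyLE
  have hcard : C * (Z.card : ℝ) ≤ C * S.wakeUps (threeLevelInstance P C sc ε δ a) :=
    mul_le_mul_of_nonneg_left (Nat.cast_le.2 (h.card_sleepingGaps_le hS)) h.C_pos.le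
  have hcompl : (Z.card : ℝ) + (Zᶜ.card : ℝ) = n := by
    exact_mod_cast (Finset.card_add_card_compl Z).trans (Fintype.card_fin n)
  have hwork := h.sum_gapWork_le hS Zᶜ
  have hR' := h.deriv_R_neg
  have hlow : ∑ i ∈ Zᶜ, (C + deriv (R P sc) (dSpeed sc ε) * gapWork P C sc ε δ a S i)
      = C * Zᶜ.card + deriv (R P sc) (dSpeed sc ε) * ∑ i ∈ Zᶜ, gapWork P C sc ε δ a S i := by
    rw [Finset.sum_add_distrib, Finset.mul_sum, Finset.sum_const, nsmul_eq_mul, mul_comm]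
  have hge := fun i hi => h.gap_cost_ge hS (hRgap i hi)
  have hnC : (n : ℝ) * C = C * Z.card + C * Zᶜ.card := by rw [← hcompl]; ring
  have hworkR : deriv (R P sc) (dSpeed sc ε) * BVolume P C sc ε a
      ≤ deriv (R P sc) (dSpeed sc ε) * ∑ i ∈ Zᶜ, gapWork P C sc ε δ a S i :=
    mul_le_mul_of_nonpos_left hwork hR'.le
  have htot := Finset.sum_le_sum hge
  have heq : ∀ i ∈ Zᶜ, C + deriv (R P sc) (dSpeed sc ε) * gapWork P C sc ε δ a S i
      = ∫ t in gap P C sc ε δ a i, R P sc (S.speed t) :=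
    (Finset.sum_eq_sum_iff_of_le hge).1 (le_antisymm htot (by linarith))
  have hB : ∑ i ∈ Zᶜ, gapWork P C sc ε δ a S i = BVolume P C sc ε a := by
    refine le_antisymm hwork ((mul_le_mul_left_of_neg hR').1 ?_)
    linarith
  rw [Finset.sum_congr rfl fun i hi => h.gapWork_eq hS (hRgap i hi) (heq i hi).ge,
    ← Finset.sum_div, BVolume, div_eq_div_iff h.k_pos.ne' (by linarith [h.k_pos])] at hB
  have hhalf : 2 * ∑ i ∈ Zᶜ, (a i : ℝ) = ∑ i, (a i : ℝ) :=
    mul_right_cancel₀ h.k_pos.ne' (by linarith)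
  have hadd := Finset.sum_add_sum_compl Z fun i => (a i : ℝ)
  refine ⟨Z, ?_⟩
  have : ∑ i ∈ Z, (a i : ℝ) = ∑ i ∈ Zᶜ, (a i : ℝ) := by linarith
  exact_mod_cast this

end Setting

/-! ### Schedules with piecewise constant speed -/

/-- Time intervals `[lo k, hi k)`, on each of which one job is run at constant speed; the processor
sleeps during the intervals that have no job. -/
structure Pieces (J K : Type*) where
  lo : K → ℝ
  hi : K → ℝ
  speed : K → ℝ
  job : K → Option J

namespace Pieces

variable {J K : Type*} [Fintype K] {I : J → Job} {p : Pieces J K}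

/-- The time interval of a piece. -/
def span (p : Pieces J K) (k : K) : Set ℝ := Ico (p.lo k) (p.hi k)

open Classical in
/-- The pieces partition the horizon of the instance `I` and process its jobs. -/
structure Valid (p : Pieces J K) (I : J → Job) : Prop where
  lt : ∀ k, p.lo k < p.hi k
  unique : ∀ t k k', t ∈ p.span k → t ∈ p.span k' → k = k'
  cover : ⋃ k, p.span k = Ico (horizonStart I) (horizonEnd I)
  separated : ∀ k k', p.job k = none → p.job k' = none → k ≠ k' →
    p.hi k < p.lo k' ∨ p.hi k' < p.lo k
  nonneg : ∀ k, 0 ≤ p.speed k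
  idle : ∀ k, p.job k = none → p.speed k = 0
  window : ∀ k j, p.job k = some j → (I j).release ≤ p.lo k ∧ p.hi k ≤ (I j).deadline
  work : ∀ j, ∑ k with p.job k = some j, p.speed k * (p.hi k - p.lo k) = (I j).volume

open Classical in
/-- The schedule that consists of the given pieces (of one of them, where they overlap). -/
noncomputable def schedule (p : Pieces J K) : Schedule J where
  job t := if h : ∃ k, t ∈ p.span k then p.job h.choose else none
  speed t := if h : ∃ k, t ∈ p.span k then p.speed h.choose else 0
  sleepPeriods := (Finset.univ.filter fun k => p.job k = none).image fun k => (p.lo k, p.hi k)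

theorem schedule_job (hp : p.Valid I) {t : ℝ} {k : K} (ht : t ∈ p.span k) :
    p.schedule.job t = p.job k := by
  have h : ∃ k, t ∈ p.span k := ⟨k, ht⟩
  exact (dif_pos h).trans (congrArg p.job (hp.unique t _ k h.choose_spec ht))

theorem schedule_speed (hp : p.Valid I) {t : ℝ} {k : K} (ht : t ∈ p.span k) :
    p.schedule.speed t = p.speed k := by
  have h : ∃ k, t ∈ p.span k := ⟨k, ht⟩
  exact (dif_pos h).trans (congrArg p.speed (hp.unique t _ k h.choose_spec ht))

theorem schedule_speed_of_notMem {t : ℝ} (ht : ¬∃ k, t ∈ p.span k) : p.schedule.speed t = 0 :=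
  dif_neg ht

theorem mem_sleepPeriods {q : ℝ × ℝ} :
    q ∈ p.schedule.sleepPeriods ↔ ∃ k, p.job k = none ∧ (p.lo k, p.hi k) = q := by
  simp [schedule]

open Classical in
theorem asleep_eq :
    p.schedule.asleep = ⋃ k ∈ Finset.univ.filter (fun k => p.job k = none), p.span k := by
  ext t
  simp only [Schedule.asleep, mem_iUnion, mem_sleepPeriods, exists_prop, Finset.mem_filter,
    Finset.mem_univ, true_and]
  constructor
  · rintro ⟨_, ⟨k, hk, rfl⟩, ht⟩
    exact ⟨k, hk, ht⟩
  · rintro ⟨k, hk, ht⟩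
    exact ⟨_, ⟨k, hk, rfl⟩, ht⟩

open Classical in
theorem setOf_job_eq (hp : p.Valid I) (j : J) :
    {t | p.schedule.job t = some j}
      = ⋃ k ∈ Finset.univ.filter (fun k => p.job k = some j), p.span k := by
  ext t
  simp only [mem_ofPred_eq, mem_iUnion, exists_prop, Finset.mem_filter, Finset.mem_univ, true_and]
  constructor
  · intro h
    by_cases ht : ∃ k, t ∈ p.span k
    · obtain ⟨k, hk⟩ := ht
      exact ⟨k, (schedule_job hp hk).symm.trans h, hk⟩
    · simp [schedule, ht] at h
  · rintro ⟨k, hk, ht⟩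
    exact (schedule_job hp ht).trans hk

open Classical in
theorem active_ae_eq (hp : p.Valid I) :
    p.schedule.active I =ᵐ[volume]
      (⋃ k ∈ Finset.univ.filter (fun k => p.job k ≠ none), p.span k : Set ℝ) := by
  have h : (⋃ k ∈ Finset.univ.filter (fun k => p.job k ≠ none), p.span k)
      = Ico (horizonStart I) (horizonEnd I) \ p.schedule.asleep := by
    rw [← hp.cover, asleep_eq]
    ext t
    simp only [mem_iUnion, mem_sdiff, Finset.mem_filter, Finset.mem_univ, true_and, exists_prop,
      not_exists, not_and]
    constructor
    · rintro ⟨k, hk, ht⟩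
      exact ⟨⟨k, ht⟩, fun k' hk' ht' => hk (hp.unique t k k' ht ht' ▸ hk')⟩
    · rintro ⟨⟨k, ht⟩, h⟩
      exact ⟨k, fun hk => h k hk ht, ht⟩
  rw [h]
  exact ae_eq_set_sdiff Ico_ae_eq_Icc.symm (ae_eq_refl _)

theorem integrableOn_span (hp : p.Valid I) (g : ℝ → ℝ) (k : K) :
    IntegrableOn (fun t => g (p.schedule.speed t)) (p.span k) :=
  (integrableOn_const (C := g (p.speed k)) measure_Ico_lt_top.ne).congr_fun
    (fun _ ht => congrArg g (schedule_speed hp ht).symm) measurableSet_Ico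

theorem integrableOn_pieces (hp : p.Valid I) (g : ℝ → ℝ) (s : Finset K) :
    IntegrableOn (fun t => g (p.schedule.speed t)) (⋃ k ∈ s, p.span k) :=
  integrableOn_finset_iUnion.2 fun k _ => integrableOn_span hp g k

theorem setIntegral_pieces (hp : p.Valid I) (g : ℝ → ℝ) (s : Finset K) :
    ∫ t in ⋃ k ∈ s, p.span k, g (p.schedule.speed t)
      = ∑ k ∈ s, g (p.speed k) * (p.hi k - p.lo k) := by
  rw [integral_biUnion_finset s (f := fun t => g (p.schedule.speed t)) (s := p.span)
    (fun k _ => measurableSet_Ico)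
    (fun k _ k' _ hne => Set.disjoint_left.2 fun t ht ht' => hne (hp.unique t k k' ht ht'))
    fun k _ => integrableOn_span hp g k]
  refine Finset.sum_congr rfl fun k _ => ?_
  have : ∫ t in p.span k, g (p.schedule.speed t) = ∫ t in p.span k, g (p.speed k) :=
    setIntegral_congr_fun measurableSet_Ico fun t ht => congrArg g (schedule_speed hp ht)
  rw [this, setIntegral_const, span, Real.volume_real_Ico_of_le (hp.lt k).le, smul_eq_mul,
    mul_comm]

theorem measurable_speed (hp : p.Valid I) : Measurable p.schedule.speed := by
  have : p.schedule.speed = fun t => ∑ k, (p.span k).indicator (fun _ => p.speed k) t := by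
    ext t
    by_cases ht : ∃ k, t ∈ p.span k
    · obtain ⟨k, hk⟩ := ht
      rw [schedule_speed hp hk, Finset.sum_eq_single k, indicator_of_mem hk]
      · exact fun k' _ hne => indicator_of_notMem (fun hk' => hne (hp.unique t k' k hk' hk)) _
      · simp
    · rw [schedule_speed_of_notMem ht, Finset.sum_eq_zero]
      exact fun k _ => indicator_of_notMem (fun hk => ht ⟨k, hk⟩) _
  rw [this]
  exact Finset.measurable_sum _ fun k _ => measurable_const.indicator measurableSet_Ico

theorem span_subset (hp : p.Valid I) (k : K) :
    horizonStart I ≤ p.lo k ∧ p.hi k ≤ horizonEnd I :=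
  (Ico_subset_Ico_iff (hp.lt k)).1 (hp.cover ▸ subset_iUnion p.span k)

theorem feasible (hp : p.Valid I) : p.schedule.Feasible I where
  sleep_valid q hq := by
    obtain ⟨k, _, rfl⟩ := mem_sleepPeriods.1 hq
    exact ⟨(span_subset hp k).1, hp.lt k, (span_subset hp k).2⟩
  sleep_separated q hq q' hq' hne := by
    obtain ⟨k, hk, rfl⟩ := mem_sleepPeriods.1 hq
    obtain ⟨k', hk', rfl⟩ := mem_sleepPeriods.1 hq'
    exact hp.separated k k' hk hk' fun h => hne (h ▸ rfl)
  speed_nonneg t := by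
    by_cases ht : ∃ k, t ∈ p.span k
    · obtain ⟨k, hk⟩ := ht
      exact schedule_speed hp hk ▸ hp.nonneg k
    · exact (schedule_speed_of_notMem ht).ge
  speed_measurable := measurable_speed hp
  job_measurable j := by
    rw [setOf_job_eq hp]
    exact Finset.measurableSet_biUnion _ fun k _ => measurableSet_Ico
  speed_idle t ht := by
    by_cases h : ∃ k, t ∈ p.span k
    · obtain ⟨k, hk⟩ := h
      rw [schedule_speed hp hk]
      exact hp.idle k ((schedule_job hp hk).symm.trans ht)
    · exact schedule_speed_of_notMem h
  job_asleep t ht := by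
    rw [asleep_eq] at ht
    obtain ⟨k, hk, htk⟩ := mem_iUnion₂.1 ht
    exact (schedule_job hp htk).trans (Finset.mem_filter.1 hk).2
  job_window t j ht := by
    classical
    have ht' : t ∈ {t | p.schedule.job t = some j} := ht
    rw [setOf_job_eq hp] at ht'
    obtain ⟨k, hk, htk⟩ := mem_iUnion₂.1 ht'
    have hw := hp.window k j (Finset.mem_filter.1 hk).2
    exact ⟨hw.1.trans htk.1, htk.2.le.trans hw.2⟩
  work_integrable j := setOf_job_eq hp j ▸ integrableOn_pieces hp id _
  work_eq j := by
    rw [setOf_job_eq hp, ← hp.work j]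
    exact setIntegral_pieces hp id _

theorem integrableOn_active (hp : p.Valid I) (g : ℝ → ℝ) :
    IntegrableOn (fun t => g (p.schedule.speed t)) (p.schedule.active I) :=
  (integrableOn_pieces hp g _).congr_set_ae (active_ae_eq hp)

open Classical in
theorem setIntegral_active (hp : p.Valid I) (g : ℝ → ℝ) :
    ∫ t in p.schedule.active I, g (p.schedule.speed t)
      = ∑ k with p.job k ≠ none, g (p.speed k) * (p.hi k - p.lo k) := by
  rw [setIntegral_congr_set (active_ae_eq hp)]
  exact setIntegral_pieces hp g _

open Classical in
theorem wakeUps_le : p.schedule.wakeUps I ≤ (Finset.univ.filter fun k => p.job k = none).card :=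
  (Finset.card_filter_le _ _).trans Finset.card_image_le

end Pieces

/-! ### The schedule of a partition -/

namespace Setting

variable {P : ℝ → ℝ} {C sc ε δ : ℝ} {n : ℕ} {a : Fin n → ℕ}

variable (sc ε) in
/-- The speed of the level 1 job in the `i`-th gap. -/
noncomputable def gapSpeed (A : Finset (Fin n)) (i : Fin n) : ℝ :=
  if i ∈ A then dSpeed sc ε else sc

variable (P C sc ε δ a) in
/-- The completion time of the level 1 job in the `i`-th gap. -/
noncomputable def completion (A : Finset (Fin n)) (i : Fin n) : ℝ :=
  blockStart P C sc ε δ a i + δ + lVolume P C sc ε a i / gapSpeed sc ε A i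

variable (P C sc ε δ a) in
/-- The schedule of a set `A` of gaps: the gaps in `A` are processed at speed `d` throughout, the
level 0 job following the level 1 job, whereas in the other gaps the processor sleeps once it has
run the level 1 job at the critical speed.  The pieces are the blocks, and the parts of the gaps
before and after the completion of the level 1 job. -/
noncomputable def partitionPieces (A : Finset (Fin n)) :
    Pieces (JobName n) (Fin (n + 1) ⊕ Fin n ⊕ Fin n) where
  lo := Sum.elim (fun j => blockStart P C sc ε δ a j)
    (Sum.elim (fun i => blockStart P C sc ε δ a i + δ) (completion P C sc ε δ a A))
  hi := Sum.elim (fun j => blockStart P C sc ε δ a j + δ)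
    (Sum.elim (completion P C sc ε δ a A) (fun i => blockStart P C sc ε δ a (i + 1)))
  speed := Sum.elim (fun _ => sc)
    (Sum.elim (gapSpeed sc ε A) (fun i => if i ∈ A then dSpeed sc ε else 0))
  job := Sum.elim (fun j => some (.level2 j))
    (Sum.elim (fun i => some (.level1 i)) (fun i => if i ∈ A then some .level0 else none))

theorem partitionPieces_job_block (A : Finset (Fin n)) (j : Fin (n + 1)) :
    (partitionPieces P C sc ε δ a A).job (.inl j) = some (.level2 j) := rfl

theorem partitionPieces_job_gap (A : Finset (Fin n)) (i : Fin n) :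
    (partitionPieces P C sc ε δ a A).job (.inr (.inl i)) = some (.level1 i) := rfl

theorem partitionPieces_job_rest (A : Finset (Fin n)) (i : Fin n) :
    (partitionPieces P C sc ε δ a A).job (.inr (.inr i))
      = if i ∈ A then some .level0 else none := rfl

theorem gapSpeed_pos (h : Setting P C sc ε δ a) (A : Finset (Fin n)) (i : Fin n) :
    0 < gapSpeed sc ε A i := by
  unfold gapSpeed
  split_ifs
  exacts [h.d_pos, h.sc_pos]

theorem d_le_gapSpeed (h : Setting P C sc ε δ a) (A : Finset (Fin n)) (i : Fin n) :
    dSpeed sc ε ≤ gapSpeed sc ε A i := by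
  unfold gapSpeed
  split_ifs
  exacts [le_rfl, h.d_lt_sc.le]

theorem lt_completion (h : Setting P C sc ε δ a) (A : Finset (Fin n)) (i : Fin n) :
    blockStart P C sc ε δ a i + δ < completion P C sc ε δ a A i := by
  have := div_pos (h.lVolume_pos i) (h.gapSpeed_pos A i)
  unfold completion
  linarith

theorem completion_lt (h : Setting P C sc ε δ a) (A : Finset (Fin n)) (i : Fin n) :
    completion P C sc ε δ a A i < blockStart P C sc ε δ a (i + 1) := by
  have : lVolume P C sc ε a i / gapSpeed sc ε A i < gapLength P C sc ε a i := by
    rw [div_lt_iff₀ (h.gapSpeed_pos A i), mul_comm]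
    exact (h.lVolume_lt i).trans_le
      (mul_le_mul_of_nonneg_right (h.d_le_gapSpeed A i) (h.gapLength_pos i).le)
  rw [completion, blockStart_succ]
  linarith

theorem exists_block {t : ℝ} (h0 : 0 ≤ t) (m : ℕ)
    (ht : t < blockStart P C sc ε δ a m) :
    ∃ j < m, blockStart P C sc ε δ a j ≤ t ∧ t < blockStart P C sc ε δ a (j + 1) := by
  induction m with
  | zero => exact (not_lt.2 h0 (blockStart_zero (P := P) ▸ ht)).elim
  | succ m ih =>
    by_cases htm : t < blockStart P C sc ε δ a m
    · obtain ⟨j, hj, hjt⟩ := ih htm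
      exact ⟨j, by omega, hjt⟩
    · exact ⟨m, by omega, not_lt.1 htm, ht⟩

theorem block_unique (h : Setting P C sc ε δ a) {t : ℝ} {i j : ℕ}
    (hi : blockStart P C sc ε δ a i ≤ t) (hi' : t < blockStart P C sc ε δ a (i + 1))
    (hj : blockStart P C sc ε δ a j ≤ t) (hj' : t < blockStart P C sc ε δ a (j + 1)) : i = j := by
  have h1 := h.blockStart_strictMono.lt_iff_lt.1 (hi.trans_lt hj')
  have h2 := h.blockStart_strictMono.lt_iff_lt.1 (hj.trans_lt hi')
  omega

theorem partitionPieces_unique (h : Setting P C sc ε δ a) (A : Finset (Fin n)) (t : ℝ)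
    (k k' : Fin (n + 1) ⊕ Fin n ⊕ Fin n) (hk : t ∈ (partitionPieces P C sc ε δ a A).span k)
    (hk' : t ∈ (partitionPieces P C sc ε δ a A).span k') : k = k' := by
  have hd := h.delta_pos
  have h1 := h.lt_completion A
  have h2 := h.completion_lt A
  have h3 := h.blockStart_add_le
  -- the number of the block that precedes, or contains, a piece
  let idx : Fin (n + 1) ⊕ Fin n ⊕ Fin n → ℕ :=
    Sum.elim (fun j => j) (Sum.elim (fun i => i) fun i => i)
  have hidx : ∀ k, t ∈ (partitionPieces P C sc ε δ a A).span k →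
      blockStart P C sc ε δ a (idx k) ≤ t ∧ t < blockStart P C sc ε δ a (idx k + 1) := by
    rintro (j | i | i) ⟨ht, ht'⟩ <;>
      simp only [partitionPieces, Sum.elim_inl, Sum.elim_inr] at ht ht' <;>
      simp only [idx, Sum.elim_inl, Sum.elim_inr]
    · exact ⟨ht, ht'.trans_le (h3 j)⟩
    · exact ⟨by linarith, ht'.trans (h2 i)⟩
    · exact ⟨by linarith [h1 i], ht'⟩
  have he := h.block_unique (hidx k hk).1 (hidx k hk).2 (hidx k' hk').1 (hidx k' hk').2
  obtain ⟨hl, hr⟩ := hk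
  obtain ⟨hl', hr'⟩ := hk'
  rcases k with j | i | i <;> rcases k' with j' | i' | i' <;>
    simp only [idx, Sum.elim_inl, Sum.elim_inr] at he <;>
    simp only [partitionPieces, Sum.elim_inl, Sum.elim_inr] at hl hr hl' hr'
  · rw [Fin.ext he]
  · rw [he] at hr
    linarith
  · rw [he] at hr
    linarith [h1 i']
  · rw [he] at hl
    linarith
  · rw [Fin.ext he]
  · rw [Fin.ext he] at hr
    linarith
  · rw [← he] at hr'
    linarith [h1 i]
  · rw [Fin.ext he] at hl
    linarith
  · rw [Fin.ext he]

theorem partitionPieces_cover (h : Setting P C sc ε δ a) (A : Finset (Fin n)) :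
    ⋃ k, (partitionPieces P C sc ε δ a A).span k = Ico 0 (blockStart P C sc ε δ a (n + 1)) := by
  have hd := h.delta_pos
  have hm := h.blockStart_strictMono.monotone
  ext t
  constructor
  · intro ht
    obtain ⟨k, hl, hr⟩ := mem_iUnion.1 ht
    rcases k with j | i | i <;>
      simp only [partitionPieces, Sum.elim_inl, Sum.elim_inr] at hl hr
    · exact ⟨(h.blockStart_nonneg j).trans hl, hr.trans_le (h.blockStart_add_le_of_lt j.2)⟩
    · exact ⟨by linarith [h.blockStart_nonneg i],
        (hr.trans (h.completion_lt A i)).trans_le (hm (by omega))⟩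
    · exact ⟨by linarith [h.blockStart_nonneg i, h.lt_completion A i], hr.trans_le (hm (by omega))⟩
  · rintro ⟨h0, ht⟩
    obtain ⟨j, hj, hjt, hjt'⟩ := exists_block h0 _ ht
    by_cases hb : t < blockStart P C sc ε δ a j + δ
    · exact mem_iUnion.2 ⟨.inl ⟨j, hj⟩, hjt, hb⟩
    · have hjn : j < n := by
        by_contra hge
        rw [blockStart_succ_of_le (not_lt.1 hge)] at hjt'
        exact hb hjt'
      by_cases hc : t < completion P C sc ε δ a A ⟨j, hjn⟩
      · exact mem_iUnion.2 ⟨.inr (.inl ⟨j, hjn⟩), not_lt.1 hb, hc⟩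
      · exact mem_iUnion.2 ⟨.inr (.inr ⟨j, hjn⟩), not_lt.1 hc, hjt'⟩

/-- The level 0 work that fits into a gap processed at speed `d`. -/
theorem d_mul_rest (h : Setting P C sc ε δ a) {A : Finset (Fin n)} {i : Fin n} (hi : i ∈ A) :
    dSpeed sc ε * (blockStart P C sc ε δ a (i + 1) - completion P C sc ε δ a A i)
      = a i / kParam P C sc ε a := by
  have := h.d_pos.ne'
  rw [blockStart_succ, completion, gapSpeed, if_pos hi]
  have e : dSpeed sc ε * (lVolume P C sc ε a i / dSpeed sc ε) = lVolume P C sc ε a i :=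
    mul_div_cancel₀ _ this
  have e2 : lVolume P C sc ε a i
      = dSpeed sc ε * gapLength P C sc ε a i - a i / kParam P C sc ε a := rfl
  linear_combination -e - e2

theorem sum_eq_half {A : Finset (Fin n)} (hA : ∑ i ∈ A, a i = ∑ i ∈ Aᶜ, a i) :
    ∑ i ∈ A, (a i : ℝ) = (∑ i, (a i : ℝ)) / 2 := by
  have h1 : ∑ i ∈ A, (a i : ℝ) = ∑ i ∈ Aᶜ, (a i : ℝ) := by exact_mod_cast hA
  linarith [Finset.sum_add_sum_compl A fun i => (a i : ℝ)]

theorem partitionPieces_valid (h : Setting P C sc ε δ a) {A : Finset (Fin n)}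
    (hA : ∑ i ∈ A, a i = ∑ i ∈ Aᶜ, a i) :
    (partitionPieces P C sc ε δ a A).Valid (threeLevelInstance P C sc ε δ a) where
  lt := by
    rintro (j | i | i)
    · exact lt_add_of_pos_right _ h.delta_pos
    · exact h.lt_completion A i
    · exact h.completion_lt A i
  unique := h.partitionPieces_unique A
  cover := by rw [h.partitionPieces_cover, h.horizonStart_eq, h.horizonEnd_eq]
  separated := by
    have key : ∀ i i' : Fin n, i < i' →
        blockStart P C sc ε δ a (i + 1) < completion P C sc ε δ a A i' := fun i i' hlt =>
      (h.blockStart_strictMono.monotone (show (i : ℕ) + 1 ≤ i' from hlt)).trans_lt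
        (by linarith [h.lt_completion A i', h.delta_pos])
    rintro (j | i | i) (j' | i' | i') hk hk' hne <;>
      simp only [partitionPieces, Sum.elim_inl, Sum.elim_inr, reduceCtorEq] at hk hk' ⊢
    have hne' : i ≠ i' := fun he => hne (he ▸ rfl)
    exact hne'.lt_or_gt.imp (key i i') (key i' i)
  nonneg := by
    rintro (j | i | i) <;> simp only [partitionPieces, Sum.elim_inl, Sum.elim_inr]
    · exact h.sc_pos.le
    · exact (h.gapSpeed_pos A i).le
    · split_ifs
      exacts [h.d_pos.le, le_rfl]
  idle := by
    rintro (j | i | i) hk <;>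
      simp only [partitionPieces, Sum.elim_inl, Sum.elim_inr, reduceCtorEq] at hk ⊢
    by_cases hi : i ∈ A <;> simp [hi] at hk ⊢
  window := by
    rintro (j | i | i) l hk <;>
      simp only [partitionPieces, Sum.elim_inl, Sum.elim_inr, Option.some.injEq] at hk ⊢
    · subst hk
      exact ⟨le_rfl, le_rfl⟩
    · subst hk
      exact ⟨le_rfl, (h.completion_lt A i).le⟩
    · by_cases hi : i ∈ A <;> simp only [hi, if_true, if_false, Option.some.injEq,
        reduceCtorEq] at hk
      subst hk
      exact ⟨by linarith [h.blockStart_nonneg i, h.lt_completion A i, h.delta_pos,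
          show (threeLevelInstance P C sc ε δ a JobName.level0).release = 0 from rfl],
        (h.blockStart_strictMono.monotone (by omega)).trans blockStart_end.le⟩
  work := by
    have hrest : ∀ l, l ≠ JobName.level0 → ∀ i,
        (partitionPieces P C sc ε δ a A).job (.inr (.inr i)) ≠ some l := by
      intro l hl i
      rw [partitionPieces_job_rest]
      split_ifs <;> simp [hl.symm]
    rintro (_ | i | j) <;> rw [Finset.sum_filter, Fintype.sum_sum_type, Fintype.sum_sum_type]
    · calc _ = ∑ i, if i ∈ A then a i / kParam P C sc ε a else 0 := by
            simp only [partitionPieces_job_block, partitionPieces_job_gap, Option.some.injEq,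
              reduceCtorEq, if_false, Finset.sum_const_zero, zero_add, partitionPieces_job_rest]
            refine Finset.sum_congr rfl fun i _ => ?_
            by_cases hi : i ∈ A
            · simp only [hi, if_true]
              rw [← h.d_mul_rest hi]
              simp [partitionPieces, hi]
            · simp [hi]
        _ = BVolume P C sc ε a := by
            rw [Finset.sum_ite_mem, Finset.univ_inter, ← Finset.sum_div, sum_eq_half hA, div_div,
              BVolume]
    · have := (h.gapSpeed_pos A i).ne'
      simp only [partitionPieces_job_block, partitionPieces_job_gap, Option.some.injEq,
        reduceCtorEq, if_false, Finset.sum_const_zero, zero_add, JobName.level1.injEq,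
        hrest (.level1 i) (by simp), add_zero, Finset.sum_ite_eq', Finset.mem_univ, if_true]
      simp [partitionPieces, completion, mul_div_cancel₀ _ this, threeLevelInstance]
    · simp only [partitionPieces_job_block, partitionPieces_job_gap, Option.some.injEq,
        reduceCtorEq, if_false, Finset.sum_const_zero, add_zero, JobName.level2.injEq,
        hrest (.level2 j) (by simp), Finset.sum_ite_eq', Finset.mem_univ, if_true]
      simp [partitionPieces, threeLevelInstance, mul_comm]

/-- The schedule of a partition costs `L_i R(d)` in each gap of `A` and `C` in each other gap, and
nothing else, relative to the critical speed. -/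
theorem schedule_of_hasPartition (h : Setting P C sc ε δ a) (hA : HasPartition a) :
    ∃ S : Schedule (JobName n),
      S.Feasible (threeLevelInstance P C sc ε δ a) ∧
      S.EnergyAtMost P C (threeLevelInstance P C sc ε δ a) (energyBound P C sc ε δ a) := by
  classical
  obtain ⟨A, hA⟩ := hA
  have hp := h.partitionPieces_valid hA
  have hf := Pieces.feasible hp
  have hint := Pieces.integrableOn_active hp P
  refine ⟨_, hf, hint, ?_⟩
  rw [hf.energy_eq hint C sc, h.energyBound_eq, add_le_add_iff_left]
  have hcard : (Finset.univ.filter fun k => (partitionPieces P C sc ε δ a A).job k = none).card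
      = Aᶜ.card := by
    rw [Finset.card_filter, Fintype.sum_sum_type, Fintype.sum_sum_type]
    simp only [partitionPieces_job_block, partitionPieces_job_gap, reduceCtorEq, if_false,
      Finset.sum_const_zero, zero_add]
    rw [Finset.card_eq_sum_ones, ← Finset.univ_inter Aᶜ, ← Finset.sum_ite_mem]
    refine Finset.sum_congr rfl fun i _ => ?_
    rw [partitionPieces_job_rest]
    by_cases hi : i ∈ A <;> simp [hi]
  have hwake : C * ((partitionPieces P C sc ε δ a A).schedule.wakeUps
      (threeLevelInstance P C sc ε δ a) : ℝ) ≤ C * Aᶜ.card :=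
    mul_le_mul_of_nonneg_left (Nat.cast_le.2 (hcard ▸ Pieces.wakeUps_le)) h.C_pos.le
  have hR : ∫ t in (partitionPieces P C sc ε δ a A).schedule.active
        (threeLevelInstance P C sc ε δ a),
        R P sc ((partitionPieces P C sc ε δ a A).schedule.speed t)
      = ∑ i ∈ A, gapLength P C sc ε a i * R P sc (dSpeed sc ε) := by
    rw [Pieces.setIntegral_active hp, Finset.sum_filter, Fintype.sum_sum_type,
      Fintype.sum_sum_type]
    have hblock : ∀ j, R P sc ((partitionPieces P C sc ε δ a A).speed (.inl j)) = 0 :=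
      fun _ => h.R_sc
    rw [Finset.sum_eq_zero fun j _ => by rw [hblock, zero_mul, ite_self], zero_add,
      ← Finset.sum_add_distrib, ← Finset.univ_inter A, ← Finset.sum_ite_mem]
    refine Finset.sum_congr rfl fun i _ => ?_
    by_cases hi : i ∈ A
    · simp only [partitionPieces_job_gap, partitionPieces_job_rest, hi, if_true, ne_eq,
        reduceCtorEq, not_false_eq_true, Finset.univ_inter]
      simp only [partitionPieces, Sum.elim_inl, Sum.elim_inr, gapSpeed, hi, if_true,
        blockStart_succ]
      ring
    · simp [partitionPieces, gapSpeed, hi, h.R_sc]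
  have hsum : ∑ i ∈ A, gapLength P C sc ε a i * R P sc (dSpeed sc ε)
      = C * A.card - (∑ i ∈ A, (a i : ℝ)) * fParam P C a * R P sc (dSpeed sc ε) := by
    simp_rw [h.gapLength_mul_R, Finset.sum_sub_distrib, Finset.sum_mul]
    rw [Finset.sum_const, nsmul_eq_mul, mul_comm]
  have hcompl : (A.card : ℝ) + (Aᶜ.card : ℝ) = n := by
    exact_mod_cast (Finset.card_add_card_compl A).trans (Fintype.card_fin n)
  rw [hR, hsum, h.BVolume_mul_deriv, sum_eq_half hA, ← hcompl]
  linarith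

end Setting

end SpeedScaling

theorem theorem1
    (C : ℝ) (hC : 0 < C)
    (P : ℝ → ℝ) (hPconv : StrictConvexOn ℝ (Set.Ici 0) P)
    (hPdiff : ∀ s : ℝ, 0 < s → DifferentiableAt ℝ P s) (hP0 : 0 < P 0)
    (sc : ℝ) (hsc : IsCriticalSpeed P sc)
    (ε : ℝ) (hε0 : 0 < ε) (hε1 : ε < 1 / 2) (δ : ℝ) (hδ : 0 < δ)
    (n : ℕ) (hn : 0 < n) (a : Fin n → ℕ) (ha : ∀ i, 0 < a i) :
    HasPartition a ↔
      ∃ S : Schedule (JobName n),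
        S.Feasible (threeLevelInstance P C sc ε δ a) ∧
        S.EnergyAtMost P C (threeLevelInstance P C sc ε δ a)
          (energyBound P C sc ε δ a) :=
  have h : Setting P C sc ε δ a := ⟨hC, hPconv, hPdiff, hP0, hsc, hε0, hε1, hδ, hn, ha⟩
  ⟨h.schedule_of_hasPartition, fun ⟨_, hS, hE⟩ => h.hasPartition_of_schedule hS hE⟩
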